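/- A quasi-metric on a set $X$ is a map $d\colon X\times X\to[0,+\infty]$ with $d(x,x)=0$, $d(x,z)\le d(x,y)+d(y,z)$, and $d(x,y)=d(y,x)=0\Rightarrow x=y$. Its open ball topology is generated by the sets $B^d_{x,<r}=\{y\mid d(x,y)<r\}$, $x\in X$, $r>0$, and $d^{sym}(x,y)=\max(d(x,y),d(y,x))$. A net is a family indexed by a non-empty directed quasi-ordered set $(I,\sqsubseteq)$; the net $(x_i)_{i\in I}$ is Cauchy if for every $\epsilon>0$ there is $i_0$ with $d(x_i,x_j)<\epsilon$ whenever $i_0\sqsubseteq i\sqsubseteq j$; a point $x$ is its $d$-limit if $d(x,y)=\limsup_i d(x_i,y)$ for every $y\in X$. The space $(X,d)$ is Smyth-complete if every Cauchy net in $(X,d)$ has a limit in the open ball topology of $d^{sym}$. It is Yoneda-complete if every Cauchy net has a $d$-limit. A formal ball is a pair $(x,r)$ with $x\in X$, $r\in[0,+\infty)$. The set $\mathbf B(X,d)$ of formal balls is ordered by $(x,r)\le^{d^+}(y,s)$ iff $d(x,y)\le r-s$, and carries the quasi-metric $d^+((x,r),(y,s))=\max(d(x,y)-r+s,0)$. A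 dcpo is a poset in which every non-empty directed subset has a supremum; a subset $U$ of a poset is Scott-open if it is upward closed and every non-empty directed set having a supremum in $U$ meets $U$. A point $x\in X$ is a center point if for every $\epsilon>0$ the open ball $B^{d^+}_{(x,0),<\epsilon}$ is Scott-open in $\mathbf B(X,d)$. **Proposition.** For every quasi-metric space $(X,d)$ the following are equivalent: 1. $(X,d)$ is Smyth-complete; 2. $(X,d)$ is Yoneda-complete and all its points are center points; 3. $\mathbf B(X,d)$ is a dcpo, and the open ball topology of $d^+$ on $\mathbf B(X,d)$ coincides with the Scott topology of $\le^{d^+}$. Moreover, the same holds if Yoneda-completeness in (2) is taken in the alternative sense that $\mathbf B(X,d)$ is a dcpo: (1)–(3) are also equivalent to (2$'$) $\mathbf B(X,d)$ is a dcpo and all points of $X$ are center points. -/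

import Mathlib

open Filter Topology
open scoped NNReal ENNReal

universe u

/-- A quasi-metric on `X`: an extended-real-valued distance, not necessarily symmetric. -/
structure QuasiMetric (X : Type u) where
  /-- The distance. -/
  d : X → X → ℝ≥0∞
  d_self : ∀ x, d x x = 0
  triangle : ∀ x y z, d x z ≤ d x y + d y z
  eq_of_d_eq_zero : ∀ x y, d x y = 0 → d y x = 0 → x = y

namespace QuasiMetric

variable {X : Type u}

/-- The open ball with center `x` and radius `r`. -/
def ball (Q : QuasiMetric X) (x : X) (r : ℝ≥0) : Set X := {y | Q.d x y < r}

/-- The open ball topology, generated by the open balls of positive radius. -/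
@[reducible]
def openBallTopology (Q : QuasiMetric X) : TopologicalSpace X :=
  TopologicalSpace.generateFrom {U | ∃ (x : X) (r : ℝ≥0), 0 < r ∧ U = Q.ball x r}

/-- The symmetrization `max (d x y) (d y x)`. -/
def sym (Q : QuasiMetric X) : QuasiMetric X where
  d x y := max (Q.d x y) (Q.d y x)
  d_self x := by simp [Q.d_self]
  triangle x y z := by
    refine max_le ?_ ?_
    · exact (Q.triangle x y z).trans (add_le_add (le_max_left _ _) (le_max_left _ _))
    · rw [add_comm]
      exact (Q.triangle z y x).trans (add_le_add (le_max_right _ _) (le_max_right _ _))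
  eq_of_d_eq_zero x y h _ := by
    have h' : Q.d x y = 0 ∧ Q.d y x = 0 := by simpa using h
    exact Q.eq_of_d_eq_zero x y h'.1 h'.2

/-- A net `x` (a family indexed by a nonempty directed quasi-ordered set) is (forward) Cauchy. -/
def IsCauchyNet (Q : QuasiMetric X) {ι : Type u} [Preorder ι] (x : ι → X) : Prop :=
  ∀ ε : ℝ≥0, 0 < ε → ∃ i₀, ∀ i j, i₀ ≤ i → i ≤ j → Q.d (x i) (x j) < ε

/-- `a` is a `d`-limit of the net `x`: `d a y = limsup d (x i) y` for every point `y`. -/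
def IsDLimit (Q : QuasiMetric X) {ι : Type u} [Preorder ι] (x : ι → X) (a : X) : Prop :=
  ∀ y, Q.d a y = limsup (fun i => Q.d (x i) y) atTop

/-- Every Cauchy net has a limit in the open ball topology of the symmetrized distance. -/
def SmythComplete (Q : QuasiMetric X) : Prop :=
  ∀ (ι : Type u) [Preorder ι] [IsDirected ι (· ≤ ·)] [Nonempty ι] (x : ι → X),
    Q.IsCauchyNet x → ∃ a, Tendsto x atTop (@nhds X Q.sym.openBallTopology a)

/-- Every Cauchy net has a `d`-limit. -/
def YonedaComplete (Q : QuasiMetric X) : Prop :=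
  ∀ (ι : Type u) [Preorder ι] [IsDirected ι (· ≤ ·)] [Nonempty ι] (x : ι → X),
    Q.IsCauchyNet x → ∃ a, Q.IsDLimit x a

/-- Formal balls `(x, r)`, with `x` a point and `r` a finite nonnegative radius. -/
@[ext]
structure FormalBall (Q : QuasiMetric X) where
  /-- The center. -/
  center : X
  /-- The radius. -/
  radius : ℝ≥0

/-- The order of formal balls: `(x, r) ≤ (y, s)` iff `d x y ≤ r - s` (subtraction of reals,
which may be negative), that is, iff `d x y + s ≤ r`. -/
instance (Q : QuasiMetric X) : PartialOrder Q.FormalBall where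
  le a b := Q.d a.center b.center + b.radius ≤ a.radius
  le_refl a := by simp [Q.d_self]
  le_trans a b c hab hbc :=
    calc Q.d a.center c.center + c.radius
        ≤ (Q.d a.center b.center + Q.d b.center c.center) + c.radius := by
          gcongr; exact Q.triangle _ _ _
      _ = Q.d a.center b.center + (Q.d b.center c.center + c.radius) := add_assoc _ _ _
      _ ≤ Q.d a.center b.center + b.radius := by gcongr
      _ ≤ a.radius := hab
  le_antisymm a b hab hba := by
    have h1 : (b.radius : ℝ≥0∞) ≤ a.radius := le_add_self.trans hab
    have h2 : (a.radius : ℝ≥0∞) ≤ b.radius := le_add_self.trans hba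
    have hr : (a.radius : ℝ≥0∞) = b.radius := le_antisymm h2 h1
    have key : ∀ (t : ℝ≥0∞) (r : ℝ≥0), t + r ≤ r → t = 0 := fun t r h =>
      nonpos_iff_eq_zero.1
        ((ENNReal.add_le_add_iff_right (ENNReal.coe_ne_top (r := r))).1 (by simpa using h))
    refine FormalBall.ext (Q.eq_of_d_eq_zero _ _ ?_ ?_) (by exact_mod_cast hr)
    · exact key _ a.radius (by simpa only [hr] using hab)
    · exact key _ a.radius (by simpa only [hr] using hba)

/-- The quasi-metric `max (d x y - r + s) 0` between formal balls `(x, r)` and `(y, s)`. The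
subtraction of extended nonnegative reals is truncated at `0`, which is the maximum with `0`. -/
def formalBallQuasiMetric (Q : QuasiMetric X) : QuasiMetric Q.FormalBall where
  d a b := (Q.d a.center b.center + b.radius) - a.radius
  d_self a := by simp [Q.d_self]
  triangle a b c := by
    rw [tsub_le_iff_right]
    have h1 : Q.d a.center b.center + b.radius
        ≤ (Q.d a.center b.center + b.radius - a.radius) + a.radius := le_tsub_add
    have h2 : Q.d b.center c.center + c.radius
        ≤ (Q.d b.center c.center + c.radius - b.radius) + b.radius := le_tsub_add
    calc Q.d a.center c.center + c.radius
        ≤ (Q.d a.center b.center + Q.d b.center c.center) + c.radius := by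
          gcongr; exact Q.triangle _ _ _
      _ = Q.d a.center b.center + (Q.d b.center c.center + c.radius) := add_assoc _ _ _
      _ ≤ Q.d a.center b.center
          + ((Q.d b.center c.center + c.radius - b.radius) + b.radius) := by gcongr
      _ = (Q.d a.center b.center + b.radius)
          + (Q.d b.center c.center + c.radius - b.radius) := by ring
      _ ≤ ((Q.d a.center b.center + b.radius - a.radius) + a.radius)
          + (Q.d b.center c.center + c.radius - b.radius) := by gcongr
      _ = _ := by ring
  eq_of_d_eq_zero a b hab hba :=
    le_antisymm (show Q.d a.center b.center + b.radius ≤ a.radius from tsub_eq_zero_iff_le.1 hab)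
      (show Q.d b.center a.center + a.radius ≤ b.radius from tsub_eq_zero_iff_le.1 hba)

/-- The Scott topology of the poset of formal balls. -/
@[reducible]
def scottTopology (Q : QuasiMetric X) : TopologicalSpace Q.FormalBall :=
  Topology.scott Q.FormalBall Set.univ

/-- `x` is a center point: every open ball around the formal ball `(x, 0)` is Scott-open. -/
def IsCenterPoint (Q : QuasiMetric X) (x : X) : Prop :=
  ∀ ε : ℝ≥0, 0 < ε → IsOpen[Q.scottTopology] (Q.formalBallQuasiMetric.ball ⟨x, 0⟩ ε)

end QuasiMetric

/-- A dcpo: a poset in which every (nonempty) directed subset has a supremum. -/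
def IsDcpo (P : Type u) [PartialOrder P] : Prop :=
  ∀ D : Set P, D.Nonempty → DirectedOn (· ≤ ·) D → ∃ a, IsLUB D a

namespace QuasiMetric

variable {X : Type u}

/-! Formal balls turn Cauchy nets into directed sets and back. The centers of a directed set `D`
form a Cauchy net, and a `d`-limit `a` of it gives the supremum `(a, inf of the radii)`; as
symmetric limits are `d`-limits, Smyth gives Yoneda, which gives a dcpo. Under Smyth-completeness
`d(x, x_i) + r_i` gets arbitrarily close to its value at the supremum, so every point is a center
point.

Conversely, a Cauchy net yields a directed set of balls `(x_i, 2^-n)` with supremum `(a, 0)`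
(`smythComplete_of_isDcpo`). Being an upper bound controls `d(x_i, a)`; `a` being a center point
controls `d(a, x_i)`.

The Scott topology is always coarser than the open ball topology, and balls about `(x, r)` are balls
about `(x, 0)`, so the two agree exactly when all points are center points. -/

lemma isOpen_openBallTopology_iff (Q : QuasiMetric X) (U : Set X) :
    IsOpen[Q.openBallTopology] U ↔ ∀ x ∈ U, ∃ ε : ℝ≥0, 0 < ε ∧ Q.ball x ε ⊆ U := by
  constructor
  · intro h
    change TopologicalSpace.GenerateOpen _ U at h
    induction h with
    | basic s hs =>
      obtain ⟨z, r, -, rfl⟩ := hs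
      intro x hx
      obtain ⟨ε, hε, hlt⟩ := ENNReal.lt_iff_exists_add_pos_lt.1 hx
      refine ⟨ε, hε, fun y hy => ?_⟩
      have hy' : Q.d x y < ε := hy
      exact ((Q.triangle z x y).trans (by gcongr)).trans_lt hlt
    | univ => exact fun x _ => ⟨1, one_pos, Set.subset_univ _⟩
    | inter s t _ _ hs ht =>
      intro x hx
      obtain ⟨ε, hε, hεs⟩ := hs x hx.1
      obtain ⟨η, hη, hηt⟩ := ht x hx.2
      refine ⟨min ε η, lt_min hε hη, fun y hy => ?_⟩
      have hy' : Q.d x y < (min ε η : ℝ≥0) := hy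
      have h1 : ((min ε η : ℝ≥0) : ℝ≥0∞) ≤ ε := by exact_mod_cast min_le_left _ _
      have h2 : ((min ε η : ℝ≥0) : ℝ≥0∞) ≤ η := by exact_mod_cast min_le_right _ _
      exact ⟨hεs (hy'.trans_le h1), hηt (hy'.trans_le h2)⟩
    | sUnion S _ hS =>
      rintro x ⟨s, hs, hx⟩
      obtain ⟨ε, hε, hεs⟩ := hS s hs x hx
      exact ⟨ε, hε, hεs.trans (Set.subset_sUnion_of_mem hs)⟩
  · intro h
    choose! ε hε hsub using h
    have hU : U = ⋃₀ {V | ∃ x ∈ U, V = Q.ball x (ε x)} := by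
      ext y
      constructor
      · intro hy
        refine ⟨_, ⟨y, hy, rfl⟩, ?_⟩
        change Q.d y y < ε y
        rw [Q.d_self]
        exact_mod_cast hε y hy
      · rintro ⟨_, ⟨x, hx, rfl⟩, hy⟩
        exact hsub x hx hy
    rw [hU]
    refine TopologicalSpace.GenerateOpen.sUnion _ ?_
    rintro _ ⟨x, hx, rfl⟩
    exact .basic _ ⟨x, ε x, hε x hx, rfl⟩

lemma isOpen_ball (Q : QuasiMetric X) (x : X) {r : ℝ≥0} (hr : 0 < r) :
    IsOpen[Q.openBallTopology] (Q.ball x r) :=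
  .basic _ ⟨x, r, hr, rfl⟩

lemma tendsto_nhds_openBallTopology_iff (Q : QuasiMetric X) {ι : Type*} {l : Filter ι}
    {x : ι → X} {a : X} :
    Tendsto x l (@nhds X Q.openBallTopology a) ↔
      ∀ ε : ℝ≥0, 0 < ε → ∀ᶠ i in l, Q.d a (x i) < ε := by
  let := Q.openBallTopology
  constructor
  · intro h ε hε
    refine h ((Q.isOpen_ball a hε).mem_nhds ?_)
    change Q.d a a < ε
    rw [Q.d_self]
    exact_mod_cast hε
  · intro h
    refine tendsto_nhds.2 fun U hU ha => ?_
    obtain ⟨ε, hε, hsub⟩ := (Q.isOpen_openBallTopology_iff U).1 hU a ha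
    filter_upwards [h ε hε] with i hi using hsub hi

/-! ### Scott topology against open ball topology -/

lemma FormalBall.le_def {Q : QuasiMetric X} {p q : Q.FormalBall} :
    p ≤ q ↔ Q.d p.center q.center + q.radius ≤ p.radius := Iff.rfl

lemma FormalBall.radius_le_of_le {Q : QuasiMetric X} {p q : Q.FormalBall} (h : p ≤ q) :
    (q.radius : ℝ≥0∞) ≤ p.radius :=
  le_add_self.trans h

lemma isOpen_scottTopology_iff (Q : QuasiMetric X) (U : Set Q.FormalBall) :
    IsOpen[Q.scottTopology] U ↔ IsUpperSet U ∧ DirSupInacc U := by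
  let := Q.scottTopology
  have : Topology.IsScott Q.FormalBall Set.univ := ⟨rfl⟩
  rw [← dirSupInaccOn_univ]
  exact Topology.IsScott.isOpen_iff_isUpperSet_and_dirSupInaccOn (D := Set.univ)

lemma mem_formalBall_ball_zero_iff (Q : QuasiMetric X) (x : X) (ε : ℝ≥0) (p : Q.FormalBall) :
    p ∈ Q.formalBallQuasiMetric.ball ⟨x, 0⟩ ε ↔ Q.d x p.center + p.radius < ε := by
  change Q.d x p.center + p.radius - ((0 : ℝ≥0) : ℝ≥0∞) < ε ↔ _
  simp

/-- Reduces all balls to those in the definition of center point. Positivity of `ε` handles the `q`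
where the subtraction truncates to `0`. -/
lemma formalBall_ball_eq (Q : QuasiMetric X) (p : Q.FormalBall) {ε : ℝ≥0} (hε : 0 < ε) :
    Q.formalBallQuasiMetric.ball p ε =
      Q.formalBallQuasiMetric.ball ⟨p.center, 0⟩ (ε + p.radius) := by
  ext q
  rw [mem_formalBall_ball_zero_iff]
  change Q.d p.center q.center + q.radius - p.radius < ε ↔ _
  rw [ENNReal.coe_add]
  refine ⟨ENNReal.lt_add_of_sub_lt_right (Or.inr ENNReal.coe_ne_top), fun h => ?_⟩
  rcases le_total (p.radius : ℝ≥0∞) (Q.d p.center q.center + q.radius) with hle | hle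
  · exact ENNReal.sub_lt_of_lt_add hle h
  · rw [tsub_eq_zero_of_le hle]
    exact_mod_cast hε

/-- A formal ball is the directed supremum of the formal balls obtained by enlarging it. -/
lemma isLUB_enlargements (Q : QuasiMetric X) (p : Q.FormalBall) :
    IsLUB {q : Q.FormalBall | ∃ ε : ℝ≥0, 0 < ε ∧ q = ⟨p.center, p.radius + ε⟩} p := by
  constructor
  · rintro _ ⟨ε, -, rfl⟩
    simp [FormalBall.le_def, Q.d_self]
  · intro b hb
    refine ENNReal.le_of_forall_pos_le_add fun ε hε _ => ?_
    exact_mod_cast FormalBall.le_def.1 (hb ⟨ε, hε, rfl⟩)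

lemma isOpen_openBallTopology_of_scott (Q : QuasiMetric X) {U : Set Q.FormalBall}
    (hU : IsOpen[Q.scottTopology] U) : IsOpen[Q.formalBallQuasiMetric.openBallTopology] U := by
  obtain ⟨hup, hin⟩ := (Q.isOpen_scottTopology_iff U).1 hU
  refine (isOpen_openBallTopology_iff _ U).2 fun p hp => ?_
  have hdir : DirectedOn (· ≤ ·)
      {q : Q.FormalBall | ∃ ε : ℝ≥0, 0 < ε ∧ q = ⟨p.center, p.radius + ε⟩} := by
    rintro _ ⟨ε, hε, rfl⟩ _ ⟨η, hη, rfl⟩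
    refine ⟨_, ⟨min ε η, lt_min hε hη, rfl⟩, ?_, ?_⟩ <;>
    · simp only [FormalBall.le_def, Q.d_self, zero_add]
      gcongr
      simp
  have hne : {q : Q.FormalBall | ∃ ε : ℝ≥0, 0 < ε ∧ q = ⟨p.center, p.radius + ε⟩}.Nonempty :=
    ⟨_, 1, one_pos, rfl⟩
  obtain ⟨_, ⟨ε, hε, rfl⟩, hεU⟩ := hin hne hdir (Q.isLUB_enlargements p) hp
  -- Every `q` in the `ε`-ball about `p` lies above the enlargement of `p` by `ε`.
  refine ⟨ε, hε, fun q hq => hup ?_ hεU⟩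
  rw [formalBall_ball_eq _ _ hε, mem_formalBall_ball_zero_iff, add_comm ε] at hq
  exact hq.le

lemma openBallTopology_eq_scottTopology_iff (Q : QuasiMetric X) :
    Q.formalBallQuasiMetric.openBallTopology = Q.scottTopology ↔ ∀ x, Q.IsCenterPoint x := by
  constructor
  · intro h x ε hε
    rw [← h]
    exact isOpen_ball _ _ hε
  · intro h
    refine le_antisymm (fun U hU => Q.isOpen_openBallTopology_of_scott hU) ?_
    refine le_generateFrom ?_
    rintro _ ⟨p, r, hr, rfl⟩
    rw [formalBall_ball_eq _ _ hr]
    exact h _ _ (by positivity)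

/-! ### Directed sets of formal balls as Cauchy nets -/

section DirectedSet

variable {Q : QuasiMetric X} {D : Set Q.FormalBall}

lemma exists_radius_lt_iInf_add (hne : D.Nonempty) {ε : ℝ≥0} (hε : 0 < ε) :
    ∃ p : D, p.1.radius < (⨅ q : D, q.1.radius) + ε := by
  have := hne.to_subtype
  exact exists_lt_of_ciInf_lt (lt_add_of_pos_right _ hε)

/-- The order bounds distances by drops in radius, and beyond a ball of radius within `ε` of the
infimum the radius drops by less than `ε`. -/
lemma isCauchyNet_center (hne : D.Nonempty) :
    Q.IsCauchyNet (fun p : D => p.1.center) := by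
  intro ε hε
  obtain ⟨p, hp⟩ := exists_radius_lt_iInf_add hne hε
  refine ⟨p, fun i j hpi hij => ?_⟩
  have h1 : Q.d i.1.center j.1.center + j.1.radius ≤ i.1.radius := hij
  have h2 := FormalBall.radius_le_of_le (show p.1 ≤ i.1 from hpi)
  have h3 : (⨅ q : D, q.1.radius) ≤ j.1.radius := ciInf_le (OrderBot.bddBelow _) j
  have h4 : Q.d i.1.center j.1.center + j.1.radius < ε + j.1.radius := by
    refine (h1.trans h2).trans_lt ?_
    rw [add_comm]
    exact_mod_cast hp.trans_le (by gcongr)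
  exact lt_of_add_lt_add_right h4

lemma isLUB_of_isDLimit (hne : D.Nonempty) (hdir : DirectedOn (· ≤ ·) D) {a : X}
    (ha : Q.IsDLimit (fun p : D => p.1.center) a) :
    IsLUB D ⟨a, ⨅ q : D, q.1.radius⟩ := by
  have := hne.to_subtype
  have : IsDirected D (· ≤ ·) := hdir.isDirectedOrder
  constructor
  · intro p hp
    refine ENNReal.le_of_forall_pos_le_add fun ε hε _ => ?_
    have h0 : limsup (fun i : D => Q.d i.1.center a) atTop < ε := by
      rw [← ha a, Q.d_self]
      exact_mod_cast hε
    obtain ⟨i, hi, hpi⟩ :=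
      ((eventually_lt_of_limsup_lt h0).and (eventually_ge_atTop (⟨p, hp⟩ : D))).exists
    have h1 : Q.d p.center i.1.center + i.1.radius ≤ p.radius := hpi
    have h2 : (⨅ q : D, q.1.radius) ≤ i.1.radius := ciInf_le (OrderBot.bddBelow _) i
    calc Q.d p.center a + (⨅ q : D, q.1.radius : ℝ≥0)
        ≤ (Q.d p.center i.1.center + Q.d i.1.center a) + i.1.radius := by
          gcongr
          exact Q.triangle _ _ _
      _ = (Q.d p.center i.1.center + i.1.radius) + Q.d i.1.center a := by ring
      _ ≤ p.radius + ε := by gcongr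
  · intro b hb
    refine ENNReal.le_of_forall_pos_le_add fun ε hε _ => ?_
    obtain ⟨p, hp⟩ := exists_radius_lt_iInf_add hne hε
    have hbp := FormalBall.radius_le_of_le (hb p.2)
    have h1 : Q.d a b.center ≤ p.1.radius - b.radius := by
      rw [ha b.center]
      refine limsup_le_of_le (h := ?_)
      filter_upwards [eventually_ge_atTop p] with i hi
      refine ENNReal.le_sub_of_add_le_right ENNReal.coe_ne_top ?_
      exact (FormalBall.le_def.1 (hb i.2)).trans (FormalBall.radius_le_of_le hi)
    calc Q.d a b.center + b.radius ≤ p.1.radius - b.radius + b.radius := by gcongr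
      _ = p.1.radius := tsub_add_cancel_of_le hbp
      _ ≤ _ := by exact_mod_cast hp.le

end DirectedSet

/-! ### Completeness, suprema and center points -/

lemma YonedaComplete.isDcpo {Q : QuasiMetric X} (h : Q.YonedaComplete) :
    IsDcpo Q.FormalBall := by
  intro D hne hdir
  have := hne.to_subtype
  have : IsDirected D (· ≤ ·) := hdir.isDirectedOrder
  obtain ⟨a, ha⟩ := h D _ (isCauchyNet_center hne)
  exact ⟨_, isLUB_of_isDLimit hne hdir ha⟩

lemma isDLimit_of_tendsto_sym {Q : QuasiMetric X} {ι : Type u} [Preorder ι]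
    [IsDirected ι (· ≤ ·)] [Nonempty ι] {x : ι → X} {a : X}
    (h : Tendsto x atTop (@nhds X Q.sym.openBallTopology a)) : Q.IsDLimit x a := by
  rw [tendsto_nhds_openBallTopology_iff] at h
  intro y
  refine le_antisymm ?_ ?_
  · refine ENNReal.le_of_forall_pos_le_add fun ε hε _ => ?_
    rw [← tsub_le_iff_right]
    refine le_limsup_of_frequently_le (Eventually.frequently ?_)
    filter_upwards [h ε hε] with i hi
    rw [tsub_le_iff_left]
    exact (Q.triangle a (x i) y).trans (by gcongr; exact (max_lt_iff.1 hi).1.le)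
  · refine ENNReal.le_of_forall_pos_le_add fun ε hε _ => ?_
    refine limsup_le_of_le (h := ?_)
    filter_upwards [h ε hε] with i hi
    rw [add_comm]
    exact (Q.triangle (x i) a y).trans (by gcongr; exact (max_lt_iff.1 hi).2.le)

lemma SmythComplete.yonedaComplete {Q : QuasiMetric X} (h : Q.SmythComplete) :
    Q.YonedaComplete := by
  intro ι _ _ _ x hx
  obtain ⟨a, ha⟩ := h ι x hx
  exact ⟨a, isDLimit_of_tendsto_sym ha⟩

lemma SmythComplete.isCenterPoint {Q : QuasiMetric X} (h : Q.SmythComplete) (x : X) :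
    Q.IsCenterPoint x := by
  intro ε hε
  rw [isOpen_scottTopology_iff]
  constructor
  · intro p q hpq hp
    rw [mem_formalBall_ball_zero_iff] at hp ⊢
    calc Q.d x q.center + q.radius
        ≤ (Q.d x p.center + Q.d p.center q.center) + q.radius := by
          gcongr
          exact Q.triangle _ _ _
      _ = Q.d x p.center + (Q.d p.center q.center + q.radius) := add_assoc _ _ _
      _ ≤ Q.d x p.center + p.radius := by gcongr; exact hpq
      _ < ε := hp
  · intro D hne hdir b hb hbε
    have := hne.to_subtype
    have : IsDirected D (· ≤ ·) := hdir.isDirectedOrder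
    obtain ⟨a, ha⟩ := h D _ (isCauchyNet_center hne)
    -- The given supremum must be the one built from the symmetric limit, so the centers also
    -- converge to its center in the direction `d(a, x_i)`.
    obtain rfl := hb.unique (isLUB_of_isDLimit hne hdir (isDLimit_of_tendsto_sym ha))
    rw [mem_formalBall_ball_zero_iff] at hbε
    obtain ⟨δ, hδ, hlt⟩ := ENNReal.lt_iff_exists_add_pos_lt.1 hbε
    obtain ⟨p, hp⟩ := exists_radius_lt_iInf_add hne (half_pos hδ)
    obtain ⟨i, hi, hpi⟩ := (((tendsto_nhds_openBallTopology_iff _).1 ha _ (half_pos hδ)).and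
      (eventually_ge_atTop p)).exists
    refine ⟨i.1, i.2, ?_⟩
    rw [mem_formalBall_ball_zero_iff]
    have h1 : (i.1.radius : ℝ≥0∞) ≤ (⨅ q : D, q.1.radius : ℝ≥0) + (δ / 2 : ℝ≥0) :=
      (FormalBall.radius_le_of_le (show p.1 ≤ i.1 from hpi)).trans (by exact_mod_cast hp.le)
    have h2 : Q.d a i.1.center ≤ (δ / 2 : ℝ≥0) := (max_lt_iff.1 hi).1.le
    calc Q.d x i.1.center + i.1.radius
        ≤ (Q.d x a + (δ / 2 : ℝ≥0)) + ((⨅ q : D, q.1.radius : ℝ≥0) + (δ / 2 : ℝ≥0)) := by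
          gcongr
          exact (Q.triangle _ a _).trans (by gcongr)
      _ = Q.d x a + (⨅ q : D, q.1.radius : ℝ≥0) + ((δ / 2 : ℝ≥0) + (δ / 2 : ℝ≥0)) := by ring
      _ = Q.d x a + (⨅ q : D, q.1.radius : ℝ≥0) + δ := by rw [← ENNReal.coe_add, add_halves]
      _ < ε := hlt

lemma smythComplete_of_isDcpo {Q : QuasiMetric X} (hD : IsDcpo Q.FormalBall)
    (hc : ∀ x, Q.IsCenterPoint x) : Q.SmythComplete := by
  intro ι _ _ _ x hx
  let δ : ℕ → ℝ≥0 := fun n => (1 / 2) ^ n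
  have hδ_pos : ∀ n, 0 < δ n := fun n => by positivity
  have hδ_add : ∀ n, δ (n + 1) + δ (n + 1) = δ n := fun n => by
    simp only [δ, pow_succ, ← mul_add, add_halves, mul_one]
  have hδ_anti : Antitone δ := pow_right_anti₀ (by positivity) (by
    rw [one_div]; exact inv_le_one_of_one_le₀ one_le_two)
  -- Asking for `δ (n + 1)`, half of `δ n`, leaves the other half for the radius `δ m` of any later
  -- ball with `n < m`.
  let good : ℕ → ι → Prop := fun n i => ∀ j, i ≤ j → Q.d (x i) (x j) ≤ δ (n + 1)
  have hgood : ∀ n, ∀ᶠ i in atTop, good n i := fun n => by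
    obtain ⟨i₀, h⟩ := hx _ (hδ_pos (n + 1))
    filter_upwards [eventually_ge_atTop i₀] with i hi j hij using (h i j hi hij).le
  let D : Set Q.FormalBall := {p | ∃ n i, good n i ∧ p = ⟨x i, δ n⟩}
  have hle : ∀ {n m i j}, good n i → i ≤ j → n < m →
      (⟨x i, δ n⟩ : Q.FormalBall) ≤ ⟨x j, δ m⟩ := by
    intro n m i j hi hij hnm
    have h1 : (δ m : ℝ≥0∞) ≤ δ (n + 1) := by exact_mod_cast hδ_anti hnm
    calc Q.d (x i) (x j) + δ m ≤ δ (n + 1) + δ (n + 1) := add_le_add (hi j hij) h1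
      _ = δ n := by exact_mod_cast hδ_add n
  have hne : D.Nonempty := by
    obtain ⟨i, hi⟩ := (hgood 0).exists
    exact ⟨_, 0, i, hi, rfl⟩
  have hdir : DirectedOn (· ≤ ·) D := by
    rintro _ ⟨n, i, hi, rfl⟩ _ ⟨m, j, hj, rfl⟩
    obtain ⟨k, hk, hik, hjk⟩ := ((hgood (max n m + 1)).and
      ((eventually_ge_atTop i).and (eventually_ge_atTop j))).exists
    exact ⟨_, ⟨_, k, hk, rfl⟩, hle hi hik (by omega), hle hj hjk (by omega)⟩
  obtain ⟨⟨a, s⟩, has⟩ := hD D hne hdir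
  have hδ_small : ∀ ε : ℝ≥0, 0 < ε → ∃ n, δ n < ε := fun ε hε =>
    exists_pow_lt_of_lt_one hε (by rw [one_div]; exact inv_lt_one_of_one_lt₀ one_lt_two)
  have hub : ∀ {n i}, good n i → Q.d (x i) a + s ≤ δ n := fun {n i} hi =>
    has.1 ⟨n, i, hi, rfl⟩
  obtain rfl : s = 0 := by
    by_contra hs
    obtain ⟨n, hn⟩ := hδ_small s (pos_iff_ne_zero.2 hs)
    obtain ⟨i, hi⟩ := (hgood n).exists
    have : (s : ℝ≥0∞) ≤ δ n := le_add_self.trans (hub hi)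
    exact (hn.trans_le (by exact_mod_cast this)).false
  refine ⟨a, (tendsto_nhds_openBallTopology_iff _).2 fun ε hε => ?_⟩
  obtain ⟨n, hn⟩ := hδ_small ε hε
  have hball : (⟨a, 0⟩ : Q.FormalBall) ∈ Q.formalBallQuasiMetric.ball ⟨a, 0⟩ ε := by
    rw [mem_formalBall_ball_zero_iff, Q.d_self]
    simpa using hε
  obtain ⟨_, ⟨m, i, hi, rfl⟩, him⟩ :=
    ((Q.isOpen_scottTopology_iff _).1 (hc a ε hε)).2 hne hdir has hball
  rw [mem_formalBall_ball_zero_iff] at him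
  -- One element of `D` in the ball suffices: its radius `δ m` exceeds the distance from `x i` to
  -- all later points.
  filter_upwards [hgood n, eventually_ge_atTop i] with j hj hij
  refine max_lt ?_ ?_
  · have h1 : (δ (m + 1) : ℝ≥0∞) ≤ δ m := by exact_mod_cast hδ_anti m.le_succ
    exact ((Q.triangle a (x i) (x j)).trans
      (add_le_add le_rfl ((hi j hij).trans h1))).trans_lt him
  · exact (le_self_add.trans (hub hj)).trans_lt (by exact_mod_cast hn)

end QuasiMetric

theorem mainTheorem10 {X : Type u} (Q : QuasiMetric X) :
    List.TFAE [
      Q.SmythComplete,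
      Q.YonedaComplete ∧ ∀ x, Q.IsCenterPoint x,
      IsDcpo Q.FormalBall ∧ ∀ x, Q.IsCenterPoint x,
      IsDcpo Q.FormalBall ∧ Q.formalBallQuasiMetric.openBallTopology = Q.scottTopology] := by
  rw [Q.openBallTopology_eq_scottTopology_iff]
  tfae_have 1 → 2 := fun h => ⟨h.yonedaComplete, h.isCenterPoint⟩
  tfae_have 2 → 3 := fun h => ⟨h.1.isDcpo, h.2⟩
  tfae_have 3 → 1 := fun h => QuasiMetric.smythComplete_of_isDcpo h.1 h.2
  tfae_have 3 ↔ 4 := Iff.rfl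
  tfae_finish
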